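/- A symmetric Friends Appreciation instance consists of a finite set of agents $\mathcal N=\{1,\dots,n\}$ and, for each agent $i$, a set of friends $F_i\subseteq\mathcal N\setminus\{i\}$ such that $i\in F_j$ if and only if $j\in F_i$. Given a partition $\pi$ of $\mathcal N$ into coalitions, let $\pi(i)$ be the coalition containing $i$. The utility of $i$ is $$u_i(\pi)=|\pi(i)\cap F_i|-\tfrac1n\,\bigl|\pi(i)\setminus(F_i\cup\{i\})\bigr|,$$ that is, each friend in the coalition of $i$ contributes $1$ and each other agent in it (an enemy) contributes $-\frac1n$. The egalitarian welfare of $\pi$ is $\mathsf{ESW}(\pi)=\min_{i\in\mathcal N}u_i(\pi)$, and $\mathsf{opt}=\max_\pi\mathsf{ESW}(\pi)$, the maximum being over all partitions of $\mathcal N$. Theorem. There is a deterministic algorithm, running in time polynomial in $n$, that, given any symmetric Friends Appreciation instance with $n$ agents (as the adjacency matrix of its friendship graph), outputs a partition $\pi$ of the agents that is a $\left(2-\frac{4}{n+2}\right)$-approximation to the maximum egalitarian welfare, i.e. $$\mathsf{opt}\le\left(2-\frac{4}{n+2}\right)\mathsf{ESW}(\pi).$$ (Polynomial time is understood on a random access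 machine whose arithmetic is addition and truncated subtraction of natural numbers at unit cost, a model polynomially equivalent to Turing machines.) -/

import Mathlib

/-! ### Hedonic games with friends and enemies, under Friends Appreciation -/

namespace FriendsGame

/-- A game with friends and enemies on the agents `Fin n`: every agent `i` has a set of friends
among the other agents; all remaining agents are enemies of `i`. -/
structure Instance (n : ℕ) where
  friends : Fin n → Finset (Fin n)
  self_notMem : ∀ i, i ∉ friends i

namespace Instance

variable {n : ℕ}

/-- Friendship is mutual. -/
def IsSymmetric (I : Instance n) : Prop :=
  ∀ i j : Fin n, i ∈ I.friends j ↔ j ∈ I.friends i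

/-- The value that `i` assigns to another agent `j` under Friends Appreciation:
`1` for a friend and `-1/n` for an enemy. -/
noncomputable def value (I : Instance n) (i j : Fin n) : ℝ :=
  if j ∈ I.friends i then 1 else -(1 / (n : ℝ))

/-- The utility of agent `i` in the coalition structure `π`: the sum of the values of the other
members of her coalition. -/
noncomputable def utility (I : Instance n) (π : Finpartition (Finset.univ : Finset (Fin n)))
    (i : Fin n) : ℝ :=
  ∑ j ∈ (π.part i).erase i, I.value i j

/-- The egalitarian welfare: the minimum of the utilities of the agents
(a minimum over a finite set; for `n = 0` it is `0` by convention). -/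
noncomputable def esw (I : Instance n) (π : Finpartition (Finset.univ : Finset (Fin n))) : ℝ :=
  ⨅ i : Fin n, I.utility π i

/-- The maximum egalitarian welfare over the (finitely many) coalition structures. -/
noncomputable def opt (I : Instance n) : ℝ :=
  ⨆ π : Finpartition (Finset.univ : Finset (Fin n)), I.esw π

/-- `π` is an `r`-approximation to the maximum egalitarian welfare. -/
def IsApprox (I : Instance n) (r : ℝ) (π : Finpartition (Finset.univ : Finset (Fin n))) : Prop :=
  I.opt ≤ r * I.esw π

end Instance

end FriendsGame

/-! ### A machine model with a step count

Structured programs for a random access machine over natural numbers. The only arithmetic is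
addition and truncated subtraction, and every elementary operation costs one step; in `t` steps
a number can grow by at most `O(t)` bits, so this model is polynomially equivalent to Turing
machines. -/

namespace RAM

/-- A memory: natural-number variables `x₀, x₁, …` and arrays `a₀, a₁, …` of natural numbers. -/
structure Mem where
  var : ℕ → ℕ
  arr : ℕ → ℕ → ℕ

/-- Expressions: constants, variables, array cells, sum and truncated difference. -/
inductive Expr where
  | lit (c : ℕ)
  | var (x : ℕ)
  | cell (a : ℕ) (i : Expr)
  | add (e₁ e₂ : Expr)
  | sub (e₁ e₂ : Expr)

namespace Expr

/-- The value of an expression. -/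
def eval (m : Mem) : Expr → ℕ
  | lit c => c
  | var x => m.var x
  | cell a i => m.arr a (i.eval m)
  | add e₁ e₂ => e₁.eval m + e₂.eval m
  | sub e₁ e₂ => e₁.eval m - e₂.eval m

/-- The number of steps that it takes to evaluate an expression. -/
def cost : Expr → ℕ
  | lit _ => 1
  | var _ => 1
  | cell _ i => i.cost + 1
  | add e₁ e₂ => e₁.cost + e₂.cost + 1
  | sub e₁ e₂ => e₁.cost + e₂.cost + 1

end Expr

/-- Programs. Tests succeed when the expression is nonzero. -/
inductive Prog where
  | skip
  | assign (x : ℕ) (e : Expr)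
  | store (a : ℕ) (i e : Expr)
  | seq (p q : Prog)
  | cond (e : Expr) (p q : Prog)
  | loop (e : Expr) (p : Prog)

/-- Assign the value `v` to the variable `x`. -/
def Mem.setVar (m : Mem) (x v : ℕ) : Mem :=
  { m with var := Function.update m.var x v }

/-- Write the value `v` into the cell `i` of the array `a`. -/
def Mem.setCell (m : Mem) (a i v : ℕ) : Mem :=
  { m with arr := Function.update m.arr a (Function.update (m.arr a) i v) }

/-- `Exec p m t m'`: the program `p`, started in the memory `m`, terminates after exactly `t` steps
in the memory `m'`. -/
inductive Exec : Prog → Mem → ℕ → Mem → Prop where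
  | skip (m : Mem) : Exec .skip m 1 m
  | assign (m : Mem) (x : ℕ) (e : Expr) :
      Exec (.assign x e) m (e.cost + 1) (m.setVar x (e.eval m))
  | store (m : Mem) (a : ℕ) (i e : Expr) :
      Exec (.store a i e) m (i.cost + e.cost + 1) (m.setCell a (i.eval m) (e.eval m))
  | seq {p q : Prog} {m m₁ m₂ : Mem} {t₁ t₂ : ℕ} :
      Exec p m t₁ m₁ → Exec q m₁ t₂ m₂ → Exec (.seq p q) m (t₁ + t₂) m₂
  | condTrue {e : Expr} {p q : Prog} {m m' : Mem} {t : ℕ} :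
      e.eval m ≠ 0 → Exec p m t m' → Exec (.cond e p q) m (e.cost + 1 + t) m'
  | condFalse {e : Expr} {p q : Prog} {m m' : Mem} {t : ℕ} :
      e.eval m = 0 → Exec q m t m' → Exec (.cond e p q) m (e.cost + 1 + t) m'
  | loopTrue {e : Expr} {p : Prog} {m m₁ m₂ : Mem} {t₁ t₂ : ℕ} :
      e.eval m ≠ 0 → Exec p m t₁ m₁ → Exec (.loop e p) m₁ t₂ m₂ →
      Exec (.loop e p) m (e.cost + 1 + t₁ + t₂) m₂
  | loopFalse {e : Expr} {p : Prog} {m : Mem} :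
      e.eval m = 0 → Exec (.loop e p) m (e.cost + 1) m

/-- Programs are deterministic: the running time and the result are determined by the input. -/
theorem Exec.unique {p : Prog} {m m₁ m₂ : Mem} {t₁ t₂ : ℕ}
    (h₁ : Exec p m t₁ m₁) (h₂ : Exec p m t₂ m₂) : t₁ = t₂ ∧ m₁ = m₂ := by
  induction h₁ generalizing t₂ m₂ with
  | skip | assign | store => cases h₂; exact ⟨rfl, rfl⟩
  | seq _ _ ih ih' =>
    cases h₂ with
    | seq a b =>
      obtain ⟨rfl, rfl⟩ := ih a
      obtain ⟨rfl, rfl⟩ := ih' b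
      exact ⟨rfl, rfl⟩
  | condTrue h _ ih =>
    cases h₂ with
    | condTrue _ a => obtain ⟨rfl, rfl⟩ := ih a; exact ⟨rfl, rfl⟩
    | condFalse h' _ => exact absurd h' h
  | condFalse h _ ih =>
    cases h₂ with
    | condTrue h' _ => exact absurd h h'
    | condFalse _ a => obtain ⟨rfl, rfl⟩ := ih a; exact ⟨rfl, rfl⟩
  | loopTrue h _ _ ih ih' =>
    cases h₂ with
    | loopTrue _ a b =>
      obtain ⟨rfl, rfl⟩ := ih a
      obtain ⟨rfl, rfl⟩ := ih' b
      exact ⟨rfl, rfl⟩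
    | loopFalse h' => exact absurd h' h
  | loopFalse h =>
    cases h₂ with
    | loopTrue h' _ _ => exact absurd h h'
    | loopFalse _ => exact ⟨rfl, rfl⟩

end RAM

namespace FriendsGame

open scoped Classical in
/-- The input of a program: the number of agents `n` in the variable `x₀`, and the `n × n` adjacency
matrix of the friendship graph, row by row, in the array `a₀`; everything else is `0`. -/
noncomputable def Instance.input {n : ℕ} (I : Instance n) : RAM.Mem where
  var x := if x = 0 then n else 0
  arr a k := if a = 0 ∧ ∃ i j : Fin n, k = (i : ℕ) * n + (j : ℕ) ∧ j ∈ I.friends i then 1 else 0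

open scoped Classical in
/-- The output of a program: the agents `i` and `j` are in the same coalition iff the cells `i`
and `j` of the array `a₁` hold the same number. -/
noncomputable def output (n : ℕ) (m : RAM.Mem) : Finpartition (Finset.univ : Finset (Fin n)) :=
  Finpartition.ofSetoid (Setoid.ker fun i : Fin n => m.arr 1 (i : ℕ))

end FriendsGame

namespace RAM

/-! ### Weakest preconditions with a time bound -/

/-! The algorithm distinguishes three cases by the minimum degree of the friendship graph; no
agent's utility exceeds her degree. Degree 0 occurs: the optimum is at most 0, and singletons
achieve 0. All degrees are at least 2: the grand coalition suffices (`isApprox_of_two_le_degree`).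
The minimum degree is 1: the optimum is at most 1, and the agents are partitioned into stars with at
least two members. Everyone then has a friend in her coalition, so a coalition of size `s`
guarantees `1 - (s - 2) / n`. If `2 * s ≤ n + 2`, this is at least `(n + 2) / (2 * n)`, the
reciprocal of the ratio. A larger star is harmless if all its leaves have degree one: another
partition either keeps that star together, which is no better for a leaf, or separates a leaf from
her only friend (`isApprox_of_star`). To build the stars, a first pass attaches every agent of
degree one to her friend. Every agent still uncovered has two friends, and two disjoint stars cannot
both contain more than half of the agents, so a second pass finds a friend whose star is not big
(`exists_not_isBig`). Joining there creates a star of at most `n / 2 + 1` or at most three agents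
(`card_star_join_le`). Correctness and running time are verified together by weakest preconditions;
the time bound is a polynomial read off the program. -/

@[simp] theorem Mem.setVar_var (m : Mem) (x v y : ℕ) :
    (m.setVar x v).var y = if y = x then v else m.var y := by
  simp [Mem.setVar, Function.update_apply]

@[simp] theorem Mem.setVar_arr (m : Mem) (x v : ℕ) : (m.setVar x v).arr = m.arr := rfl

@[simp] theorem Mem.setCell_var (m : Mem) (a i v : ℕ) : (m.setCell a i v).var = m.var := rfl

@[simp] theorem Mem.setCell_arr (m : Mem) (a i v b j : ℕ) :
    (m.setCell a i v).arr b j = if b = a ∧ j = i then v else m.arr b j := by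
  by_cases h : b = a
  · subst h; simp [Mem.setCell, Function.update_apply]
  · simp [Mem.setCell, h]

namespace Prog

open Polynomial in
/-- A bound for the running time of a program each of whose loops makes at most `X` rounds
whenever it is entered. -/
noncomputable def time : Prog → ℕ[X]
  | skip => 1
  | assign _ e => C (e.cost + 1)
  | store _ i e => C (i.cost + e.cost + 1)
  | seq p q => p.time + q.time
  | cond e p q => C (e.cost + 1) + (p.time + q.time)
  | loop e p => C (e.cost + 1) + X * (C (e.cost + 1) + p.time)

/-- The weakest precondition: started in `m`, the program `p` terminates within the time
`p.time.eval n` in a memory that satisfies `Q`. -/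
def WP (n : ℕ) (p : Prog) (Q : Mem → Prop) (m : Mem) : Prop :=
  ∃ t m', Exec p m t m' ∧ t ≤ p.time.eval n ∧ Q m'

variable {n : ℕ} {p q : Prog} {Q R : Mem → Prop} {m : Mem}

theorem WP.mono (h : WP n p Q m) (hQ : ∀ m', Q m' → R m') : WP n p R m := by
  obtain ⟨t, m', h₁, h₂, h₃⟩ := h
  exact ⟨t, m', h₁, h₂, hQ _ h₃⟩

theorem WP.skip (h : Q m) : WP n .skip Q m := ⟨_, _, .skip m, by simp [time], h⟩

theorem WP.assign {x : ℕ} {e : Expr} (h : Q (m.setVar x (e.eval m))) : WP n (.assign x e) Q m :=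
  ⟨_, _, .assign m x e, by simp [time], h⟩

theorem WP.store {a : ℕ} {i e : Expr} (h : Q (m.setCell a (i.eval m) (e.eval m))) :
    WP n (.store a i e) Q m :=
  ⟨_, _, .store m a i e, by simp [time], h⟩

theorem WP.seq (h : WP n p (WP n q Q) m) : WP n (.seq p q) Q m := by
  obtain ⟨t, m₁, h₁, h₂, t', m', h₃, h₄, h₅⟩ := h
  exact ⟨_, _, .seq h₁ h₃, by simpa [time] using add_le_add h₂ h₄, h₅⟩

theorem WP.cond {e : Expr} (hp : e.eval m ≠ 0 → WP n p Q m) (hq : e.eval m = 0 → WP n q Q m) :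
    WP n (.cond e p q) Q m := by
  by_cases h : e.eval m = 0
  · obtain ⟨t, m', h₁, h₂, h₃⟩ := hq h
    exact ⟨_, _, .condFalse h h₁, by simp [time]; omega, h₃⟩
  · obtain ⟨t, m', h₁, h₂, h₃⟩ := hp h
    exact ⟨_, _, .condTrue h h₁, by simp [time]; omega, h₃⟩

/-- The invariant is indexed by the number of completed rounds and forces exactly `n` rounds. This
is what makes `X` a valid round count in `time`; nested loops then multiply to a polynomial. -/
theorem WP.loop {e : Expr} (I : ℕ → Mem → Prop) (h₀ : I 0 m)
    (hstep : ∀ k < n, ∀ m, I k m → e.eval m ≠ 0 ∧ WP n p (I (k + 1)) m)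
    (hend : ∀ m, I n m → e.eval m = 0 ∧ Q m) : WP n (.loop e p) Q m := by
  have key : ∀ j k m, k + j = n → I k m → ∃ t m', Exec (.loop e p) m t m' ∧
      t ≤ e.cost + 1 + j * (e.cost + 1 + p.time.eval n) ∧ Q m' := by
    intro j
    induction j with
    | zero =>
      intro k m hk hI
      obtain rfl : k = n := by omega
      obtain ⟨h₁, h₂⟩ := hend m hI
      exact ⟨_, _, .loopFalse h₁, by simp, h₂⟩
    | succ j ih =>
      intro k m hk hI
      obtain ⟨he, t, m₁, h₁, h₂, h₃⟩ := hstep k (by omega) m hI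
      obtain ⟨t', m', h₄, h₅, h₆⟩ := ih (k + 1) m₁ (by omega) h₃
      exact ⟨_, _, .loopTrue he h₁ h₄, by rw [add_mul]; omega, h₆⟩
  obtain ⟨t, m', h₁, h₂, h₃⟩ := key n 0 m (by simp) h₀
  exact ⟨t, m', h₁, by simpa [time] using h₂, h₃⟩

/-- Run `p` with the variable `x` taking the values `0, 1, …`, below the value of the
variable `0`. -/
def forTo (x : ℕ) (p : Prog) : Prog :=
  .seq (.assign x (.lit 0)) (.loop (.sub (.var 0) (.var x))
    (.seq p (.assign x (.add (.var x) (.lit 1)))))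

theorem WP.forTo {x : ℕ} (I : ℕ → Mem → Prop) (hvar : ∀ k m, I k m → m.var 0 = n ∧ m.var x = k)
    (h₀ : I 0 (m.setVar x 0))
    (hstep : ∀ k < n, ∀ m, I k m →
      WP n p (fun m' => m'.var x = k ∧ I (k + 1) (m'.setVar x (k + 1))) m)
    (hend : ∀ m, I n m → Q m) : WP n (forTo x p) Q m := by
  refine .seq (.assign (.loop I h₀ (fun k hk m hI => ?_) fun m hI => ?_))
  · obtain ⟨h₁, h₂⟩ := hvar k m hI
    refine ⟨by simp only [Expr.eval, h₁, h₂]; omega, .seq ((hstep k hk m hI).mono ?_)⟩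
    rintro m' ⟨h₃, h₄⟩
    exact .assign (by simpa [Expr.eval, h₃] using h₄)
  · obtain ⟨h₁, h₂⟩ := hvar n m hI
    exact ⟨by simp [Expr.eval, h₁, h₂], hend m hI⟩

end Prog

end RAM

/-! ### Bounds on utilities and welfare, and the approximation ratio in each degree case -/

namespace FriendsGame

namespace Instance

variable {n : ℕ}

theorem utility_eq (I : Instance n) (π : Finpartition (Finset.univ : Finset (Fin n)))
    (i : Fin n) : I.utility π i = ((π.part i ∩ I.friends i).card : ℝ) -
      ((π.part i).card - 1 - (π.part i ∩ I.friends i).card) / n := by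
  have hi : i ∈ π.part i := π.mem_part (Finset.mem_univ i)
  have h₁ : ((π.part i).erase i).filter (· ∈ I.friends i) = π.part i ∩ I.friends i := by
    ext j
    have := I.self_notMem i
    simp only [Finset.mem_filter, Finset.mem_erase, Finset.mem_inter]
    constructor
    · tauto
    · rintro ⟨h, h'⟩
      exact ⟨⟨by rintro rfl; exact this h', h⟩, h'⟩
  have h₂ := Finset.card_filter_add_card_filter_not (s := (π.part i).erase i)
    (· ∈ I.friends i)
  rw [h₁] at h₂
  have h₃ := Finset.card_erase_add_one hi
  have h₄ : ((((π.part i).erase i).filter (¬ · ∈ I.friends i)).card : ℝ)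
      = (π.part i).card - 1 - (π.part i ∩ I.friends i).card := by
    rw [← h₃, ← h₂]; push_cast; ring
  simp only [utility, value]
  rw [Finset.sum_ite, Finset.sum_const, Finset.sum_const, h₁, nsmul_eq_mul, nsmul_eq_mul, h₄]
  ring

theorem utility_le_inter (I : Instance n) (π : Finpartition (Finset.univ : Finset (Fin n)))
    (i : Fin n) : I.utility π i ≤ ((π.part i ∩ I.friends i).card : ℝ) := by
  have hi : i ∈ π.part i := π.mem_part (Finset.mem_univ i)
  have h : (π.part i ∩ I.friends i).card + 1 ≤ (π.part i).card := by
    rw [← Finset.card_erase_add_one hi]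
    gcongr
    intro j hj
    obtain ⟨h₁, h₂⟩ := Finset.mem_inter.1 hj
    exact Finset.mem_erase.2 ⟨by rintro rfl; exact I.self_notMem _ h₂, h₁⟩
  have h' : ((π.part i ∩ I.friends i).card : ℝ) + 1 ≤ (π.part i).card := by exact_mod_cast h
  rw [utility_eq, sub_le_self_iff]
  exact div_nonneg (by linarith) (by positivity)

theorem utility_le_degree (I : Instance n) (π : Finpartition (Finset.univ : Finset (Fin n)))
    (i : Fin n) : I.utility π i ≤ (I.friends i).card :=
  (I.utility_le_inter π i).trans (by exact_mod_cast Finset.card_le_card Finset.inter_subset_right)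

/-- The utility of an agent none of whose friends is in her coalition is not positive. -/
theorem utility_nonpos_of_disjoint (I : Instance n)
    (π : Finpartition (Finset.univ : Finset (Fin n))) (i : Fin n)
    (h : Disjoint (π.part i) (I.friends i)) : I.utility π i ≤ 0 := by
  simpa [Finset.disjoint_iff_inter_eq_empty.1 h] using I.utility_le_inter π i

theorem utility_nonpos_of_card_part_le_one (I : Instance n)
    (π : Finpartition (Finset.univ : Finset (Fin n))) (i : Fin n)
    (h : (π.part i).card ≤ 1) : I.utility π i ≤ 0 := by
  refine I.utility_nonpos_of_disjoint π i (Finset.disjoint_left.2 fun j hj hj' => ?_)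
  obtain rfl := Finset.card_le_one.1 h j hj i (π.mem_part (Finset.mem_univ i))
  exact I.self_notMem _ hj'

/-- One friend contributes 1, and at worst the other `s - 2` members are enemies. For an agent of
degree one the same quantity is an upper bound (`utility_le_of_degree_eq_one`), which is why big
stars with pendant leaves can be optimal. -/
theorem le_utility_of_mem (I : Instance n) (π : Finpartition (Finset.univ : Finset (Fin n)))
    {i j : Fin n} (hj : j ∈ π.part i) (hij : j ∈ I.friends i) :
    1 - (((π.part i).card : ℝ) - 2) / n ≤ I.utility π i := by
  have h : 1 ≤ (π.part i ∩ I.friends i).card :=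
    Finset.card_pos.2 ⟨j, Finset.mem_inter.2 ⟨hj, hij⟩⟩
  have h' : (1 : ℝ) ≤ (π.part i ∩ I.friends i).card := by exact_mod_cast h
  rw [utility_eq]
  have : ((π.part i).card - 1 - (π.part i ∩ I.friends i).card : ℝ) / n
      ≤ ((π.part i).card - 2) / n :=
    div_le_div_of_nonneg_right (by linarith) (by positivity)
  linarith

theorem utility_le_of_degree_eq_one (I : Instance n)
    (π : Finpartition (Finset.univ : Finset (Fin n))) {i : Fin n}
    (hi : (I.friends i).card = 1) : I.utility π i ≤ 1 - (((π.part i).card : ℝ) - 2) / n := by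
  have h : (π.part i ∩ I.friends i).card ≤ 1 :=
    hi ▸ Finset.card_le_card Finset.inter_subset_right
  have h' : ((π.part i ∩ I.friends i).card : ℝ) ≤ 1 := by exact_mod_cast h
  rw [utility_eq]
  have : ((π.part i).card - 2 : ℝ) / n ≤
    ((π.part i).card - 1 - (π.part i ∩ I.friends i).card : ℝ) / n :=
    div_le_div_of_nonneg_right (by linarith) (by positivity)
  linarith

theorem esw_le (I : Instance n) (π : Finpartition (Finset.univ : Finset (Fin n))) (i : Fin n) :
    I.esw π ≤ I.utility π i :=
  ciInf_le (Set.finite_range _).bddBelow i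

theorem opt_le (I : Instance n) {a : ℝ} (h : ∀ π, ∃ i, I.utility π i ≤ a) : I.opt ≤ a :=
  ciSup_le fun π => let ⟨i, hi⟩ := h π; (I.esw_le π i).trans hi

theorem opt_le_degree (I : Instance n) (i : Fin n) : I.opt ≤ (I.friends i).card :=
  I.opt_le fun π => ⟨i, I.utility_le_degree π i⟩

theorem exists_esw_eq (I : Instance n) (π : Finpartition (Finset.univ : Finset (Fin n)))
    (i₀ : Fin n) : ∃ i, I.esw π = I.utility π i :=
  have : Nonempty (Fin n) := ⟨i₀⟩
  let ⟨i, hi⟩ := exists_eq_ciInf_of_finite (f := fun i => I.utility π i)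
  ⟨i, hi.symm⟩

theorem isApprox_of_eq_zero (I : Instance n) (r : ℝ)
    (π : Finpartition (Finset.univ : Finset (Fin n))) (hn : n = 0) : I.IsApprox r π := by
  subst hn
  simp [IsApprox, opt, esw]

theorem isApprox_of_degree_eq_zero (I : Instance n) (r : ℝ)
    (π : Finpartition (Finset.univ : Finset (Fin n))) {i₀ : Fin n}
    (h₀ : (I.friends i₀).card = 0) (hπ : ∀ i, π.part i = {i}) : I.IsApprox r π := by
  have h₁ : I.opt ≤ 0 := by simpa [h₀] using I.opt_le_degree i₀
  have h₂ : I.esw π = 0 := by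
    obtain ⟨i, hi⟩ := I.exists_esw_eq π i₀
    rw [hi, utility, hπ]
    simp
  simpa [IsApprox, h₂] using h₁

theorem isApprox_of_two_le_degree (I : Instance n)
    (π : Finpartition (Finset.univ : Finset (Fin n)))
    (h₀ : ∀ i, 2 ≤ (I.friends i).card) (hπ : ∀ i, π.part i = Finset.univ) :
    I.IsApprox (2 - 4 / ((n : ℝ) + 2)) π := by
  rcases Nat.eq_zero_or_pos n with hn | hn
  · exact I.isApprox_of_eq_zero _ _ hn
  obtain ⟨i, hi⟩ := I.exists_esw_eq π ⟨0, hn⟩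
  have h₁ := I.opt_le_degree i
  have h₂ : (2 : ℝ) ≤ (I.friends i).card := by exact_mod_cast h₀ i
  have hn' : (0 : ℝ) < n := by exact_mod_cast hn
  rw [IsApprox, hi, utility_eq, hπ, Finset.univ_inter, Finset.card_univ, Fintype.card_fin]
  refine h₁.trans ?_
  have e : (2 - 4 / ((n : ℝ) + 2)) * ((I.friends i).card - (n - 1 - (I.friends i).card) / n)
      = 2 * ((I.friends i).card * (n + 1) - (n - 1)) / (n + 2) := by
    field_simp
    ring
  -- With `d` the degree, what remains is equivalent to `2 * (n - 1) ≤ d * n`, which follows from `2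
  -- ≤ d`.
  rw [e, le_div_iff₀ (by positivity)]
  nlinarith

/-- If every agent has a friend in her coalition, and every coalition either is small or consists
of one agent and agents of degree one that are her friends, then the approximation ratio holds. -/
theorem isApprox_of_star (I : Instance n)
    (π : Finpartition (Finset.univ : Finset (Fin n))) {i₀ : Fin n}
    (h₀ : (I.friends i₀).card = 1) (hfriend : ∀ i, ∃ j ∈ π.part i, j ∈ I.friends i)
    (hsize : ∀ i, 2 * (π.part i).card ≤ n + 2 ∨ (π.part i).card ≤ 3 ∨
      ∃ w ∈ π.part i, ∀ j ∈ π.part i, j ≠ w → (I.friends j).card = 1 ∧ w ∈ I.friends j) :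
    I.IsApprox (2 - 4 / ((n : ℝ) + 2)) π := by
  obtain ⟨i, hi⟩ := I.exists_esw_eq π i₀
  obtain ⟨j, hj, hij⟩ := hfriend i
  have h₁ := I.le_utility_of_mem π hj hij
  have hcard : 2 ≤ (π.part i).card :=
    Finset.one_lt_card.2 ⟨i, π.mem_part (Finset.mem_univ i), j, hj,
      by rintro rfl; exact I.self_notMem _ hij⟩
  have hn : (π.part i).card ≤ n := by simpa using Finset.card_le_univ (π.part i)
  have hn2 : (2 : ℝ) ≤ n := by exact_mod_cast hcard.trans hn
  have hr : 1 ≤ 2 - 4 / ((n : ℝ) + 2) := by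
    have : 4 / ((n : ℝ) + 2) ≤ 1 := by rw [div_le_one (by positivity)]; linarith
    linarith
  set s := (π.part i).card with hs
  have hnonneg : 0 ≤ 1 - ((s : ℝ) - 2) / n := by
    have : (s : ℝ) ≤ n := by exact_mod_cast hn
    have : ((s : ℝ) - 2) / n ≤ 1 := by rw [div_le_one (by linarith)]; linarith
    linarith
  -- Here `π` is already optimal, and the ratio is at least 1 because `2 ≤ n`.
  have hdirect : I.opt ≤ 1 - ((s : ℝ) - 2) / n → I.IsApprox (2 - 4 / ((n : ℝ) + 2)) π := by
    intro h
    rw [IsApprox, hi]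
    nlinarith
  have hsmall : 2 * s ≤ n + 2 → I.IsApprox (2 - 4 / ((n : ℝ) + 2)) π := by
    intro h
    have hopt : I.opt ≤ 1 := by simpa [h₀] using I.opt_le_degree i₀
    have h' : 2 * (s : ℝ) ≤ n + 2 := by exact_mod_cast h
    rw [IsApprox, hi]
    -- This is the value of `1 - (s - 2) / n` at `s = (n + 2) / 2`.
    have h₂ : ((n : ℝ) + 2) / (2 * n) ≤ I.utility π i := by
      refine le_trans ?_ h₁
      rw [div_le_iff₀ (by linarith)]
      have : (1 - ((s : ℝ) - 2) / n) * (2 * n) = 2 * n - 2 * (s - 2) := by field_simp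
      linarith
    have h₃ : (2 - 4 / ((n : ℝ) + 2)) * (((n : ℝ) + 2) / (2 * n)) = 1 := by field_simp; ring
    have h₄ : (2 - 4 / ((n : ℝ) + 2)) * (((n : ℝ) + 2) / (2 * n)) ≤
      (2 - 4 / ((n : ℝ) + 2)) * I.utility π i := by gcongr
    linarith
  rcases hsize i with h | h | ⟨w, hw, hleaf⟩
  · exact hsmall h
  · by_cases hsn : 2 * s ≤ n + 2
    · exact hsmall hsn
    -- The only exception to the size bound is `s = n = 3`: a partition of three agents is the grand
    -- coalition or isolates someone.
    · refine hdirect (I.opt_le fun ρ => ?_)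
      have hs3 : s = 3 := by omega
      have hn3 : n = 3 := by omega
      by_cases hρ : 3 ≤ (ρ.part i₀).card
      · refine ⟨i₀, (I.utility_le_of_degree_eq_one ρ h₀).trans ?_⟩
        have : (s : ℝ) ≤ (ρ.part i₀).card := by exact_mod_cast hs3.trans_le hρ
        gcongr
      · obtain ⟨z, hz⟩ : ∃ z, z ∉ ρ.part i₀ := by
          by_contra! hall
          have := Finset.card_le_card (show Finset.univ ⊆ ρ.part i₀ from fun z _ => hall z)
          simp at this
          omega
        have hdisj : Disjoint (ρ.part i₀) (ρ.part z) := by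
          refine ρ.disjoint (ρ.part_mem.2 (Finset.mem_univ _)) (ρ.part_mem.2 (Finset.mem_univ _)) ?_
          intro heq
          exact hz (heq ▸ ρ.mem_part (Finset.mem_univ z))
        have hle : (ρ.part i₀).card + (ρ.part z).card ≤ n := by
          rw [← Finset.card_union_of_disjoint hdisj]
          simpa using Finset.card_le_univ (ρ.part i₀ ∪ ρ.part z)
        by_cases h1 : (ρ.part i₀).card ≤ 1
        · exact ⟨i₀, (I.utility_nonpos_of_card_part_le_one ρ i₀ h1).trans hnonneg⟩
        · exact ⟨z, (I.utility_nonpos_of_card_part_le_one ρ z (by omega)).trans hnonneg⟩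
  · refine hdirect (I.opt_le fun ρ => ?_)
    -- If `ρ` keeps the star together, a leaf has at least as many enemies as in `π`; otherwise some
    -- leaf loses her only friend `w`.
    by_cases hall : ∀ j ∈ π.part i, j ∈ ρ.part w
    · obtain ⟨j, hj, hjw⟩ := Finset.exists_mem_ne hcard w
      refine ⟨j, (I.utility_le_of_degree_eq_one ρ (hleaf j hj hjw).1).trans ?_⟩
      have h₃ : ρ.part j = ρ.part w :=
        ρ.part_eq_of_mem (ρ.part_mem.2 (Finset.mem_univ w)) (hall j hj)
      have : (s : ℝ) ≤ (ρ.part j).card := by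
        rw [h₃]; exact_mod_cast Finset.card_le_card hall
      gcongr
    · push Not at hall
      obtain ⟨j, hj, hjw⟩ := hall
      have hne : j ≠ w := by rintro rfl; exact hjw (ρ.mem_part (Finset.mem_univ j))
      obtain ⟨h₂, h₃⟩ := hleaf j hj hne
      refine ⟨j, (I.utility_nonpos_of_disjoint ρ j
        (Finset.disjoint_left.2 fun k hk hk' => ?_)).trans hnonneg⟩
      obtain rfl := Finset.card_le_one.1 h₂.le k hk' w h₃
      have h₄ : ρ.part k = ρ.part j :=
        ρ.part_eq_of_mem (ρ.part_mem.2 (Finset.mem_univ j)) hk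
      exact hjw (h₄ ▸ ρ.mem_part (Finset.mem_univ j))

end Instance

theorem mem_part_output {n : ℕ} (m : RAM.Mem) (i j : Fin n) :
    j ∈ (output n m).part i ↔ m.arr 1 (j : ℕ) = m.arr 1 (i : ℕ) := by
  classical
  rw [output, Finpartition.mem_part_ofSetoid_iff_rel, Setoid.ker_def, eq_comm]

/-! ### Partial partitions into stars

A partial partition of the agents into stars is given by the centre of the star of each agent;
an agent in no star is sent to `none`. -/

variable {n : ℕ}

/-- The star with centre `w`. -/
def star (c : Fin n → Option (Fin n)) (w : Fin n) : Finset (Fin n) :=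
  Finset.univ.filter (c · = some w)

@[simp] theorem mem_star {c : Fin n → Option (Fin n)} {w z : Fin n} :
    z ∈ star c w ↔ c z = some w := by
  simp [star]

/-- Put `u` into a star with centre `v`, making `v` a centre first: if `v` is a leaf of another
star, it leaves that star, and takes the centre with it if no other leaf is left. -/
def join (c : Fin n → Option (Fin n)) (u v : Fin n) (z : Fin n) : Option (Fin n) :=
  if z = u ∨ z = v ∨ (c v = some z ∧ (star c z).card ≤ 2) then some v else c z

/-- The star with centre `v` is big. -/
def IsBig (c : Fin n → Option (Fin n)) (v : Fin n) : Prop :=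
  n + 1 ≤ 2 * (star c v).card

namespace Instance

/-- `c` describes disjoint stars of the friendship graph, none of them a single agent. -/
structure IsStars (I : Instance n) (c : Fin n → Option (Fin n)) : Prop where
  center : ∀ u w, c u = some w → c w = some w
  mem_friends : ∀ u w, c u = some w → u ≠ w → w ∈ I.friends u
  two_le_card : ∀ w, c w = some w → 2 ≤ (star c w).card

/-- All leaves have degree one. -/
def LeavesPendant (I : Instance n) (c : Fin n → Option (Fin n)) : Prop :=
  ∀ u w, c u = some w → u ≠ w → (I.friends u).card = 1

/-- Every star is small or has only leaves of degree one. -/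
def IsBalanced (I : Instance n) (c : Fin n → Option (Fin n)) : Prop :=
  ∀ u w, c u = some w → u ≠ w → (I.friends u).card = 1 ∨
    2 * (star c w).card ≤ n + 2 ∨ (star c w).card ≤ 3

end Instance

theorem join_ne_none {c : Fin n → Option (Fin n)} {u v z : Fin n} (h : c z ≠ none) :
    join c u v z ≠ none := by
  unfold join
  split_ifs
  · simp
  · exact h

theorem join_self_ne_none (c : Fin n → Option (Fin n)) (u v : Fin n) :
    join c u v u ≠ none := by
  simp [join]

theorem star_join_subset {c : Fin n → Option (Fin n)} {u v w : Fin n} (h : w ≠ v) :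
    star (join c u v) w ⊆ star c w := by
  intro z hz
  rw [mem_star, join] at hz
  split_ifs at hz
  · exact absurd (Option.some.inj hz).symm h
  · exact mem_star.2 hz

/-! ### Invariants of the join operation, and the ratio for balanced stars -/

namespace Instance.IsStars

variable {I : Instance n} {c : Fin n → Option (Fin n)} {u v : Fin n}

/-- A star of at least three agents survives the loss of the leaf `v`. In a star of two, the
abandoned centre becomes a leaf of `v`, which symmetry of friendship permits. -/
theorem join (hI : I.IsSymmetric) (hc : I.IsStars c) (hu : c u = none) (huv : v ∈ I.friends u) :
    I.IsStars (join c u v) where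
  center z w hz := by
    rw [FriendsGame.join] at hz
    split_ifs at hz with h
    · obtain rfl := Option.some.inj hz
      simp [FriendsGame.join]
    · push Not at h
      have hw := hc.center z w hz
      rw [FriendsGame.join]
      split_ifs with h'
      · rcases h' with rfl | rfl | ⟨h₁, h₂⟩
        · simp [hu] at hw
        · rfl
        · by_cases hwv : w = v
          · rw [hwv]
          exfalso
          -- The centre `w` moves only if its star has at most two members, yet `z`, `w` and `v`
          -- would all belong to it.
          have hzw : z ≠ w := by rintro rfl; exact absurd h₂ (not_le.2 (h.2.2 h₁))
          have : ({z, w, v} : Finset (Fin n)).card ≤ (star c w).card := by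
            refine Finset.card_le_card fun x hx => ?_
            simp only [Finset.mem_insert, Finset.mem_singleton] at hx
            rcases hx with rfl | rfl | rfl <;> simp [*]
          rw [Finset.card_eq_three.2 ⟨z, w, v, hzw, h.2.1, hwv, rfl⟩] at this
          omega
      · exact hw
  mem_friends z w hz hne := by
    rw [FriendsGame.join] at hz
    split_ifs at hz with h
    · obtain rfl := Option.some.inj hz
      rcases h with rfl | rfl | ⟨h, -⟩
      · exact huv
      · exact absurd rfl hne
      · exact (hI _ _).2 (hc.mem_friends _ _ h hne.symm)
    · exact hc.mem_friends z w hz hne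
  two_le_card w hw := by
    have huv' : u ≠ v := by rintro rfl; exact I.self_notMem _ huv
    by_cases hwv : w = v
    · subst hwv
      exact Finset.one_lt_card.2 ⟨u, by simp [FriendsGame.join], w, by simpa using hw, huv'⟩
    · rw [FriendsGame.join] at hw
      split_ifs at hw with h
      · exact absurd (Option.some.inj hw).symm hwv
      · push Not at h
        have hsub : (star c w).erase v ⊆ star (FriendsGame.join c u v) w := by
          intro z hz
          obtain ⟨hzv, hz⟩ := Finset.mem_erase.1 hz
          rw [mem_star] at hz ⊢
          rw [FriendsGame.join, if_neg, hz]
          rintro (rfl | rfl | ⟨h₁, h₂⟩)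
          · simp [hu] at hz
          · exact hzv rfl
          · have := hc.center _ _ h₁
            rw [hz] at this
            obtain rfl := Option.some.inj this
            exact absurd h₂ (not_le.2 (h.2.2 h₁))
        have h₁ := Finset.card_le_card hsub
        have h₂ := hc.two_le_card w hw
        by_cases hv : v ∈ star c w
        · have := h.2.2 (mem_star.1 hv)
          have := Finset.card_erase_add_one hv
          omega
        · rw [Finset.erase_eq_of_notMem hv] at h₁
          omega

/-- If `v` is a centre, its star gains only `u`, and not being big means `2 * s ≤ n`. Otherwise the
new star contains at most `u`, `v` and the former centre of `v`. -/
theorem card_star_join_le (hc : I.IsStars c) (hv : ¬ IsBig c v) :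
    2 * (star (FriendsGame.join c u v) v).card ≤ n + 2 ∨
      (star (FriendsGame.join c u v) v).card ≤ 3 := by
  by_cases h : c v = some v
  · left
    have hsub : star (FriendsGame.join c u v) v ⊆ insert u (star c v) := by
      intro z hz
      rw [mem_star, FriendsGame.join] at hz
      rw [Finset.mem_insert, mem_star]
      split_ifs at hz with h'
      · rcases h' with rfl | rfl | ⟨h₁, -⟩
        · exact Or.inl rfl
        · exact Or.inr h
        · rw [h] at h₁
          obtain rfl := Option.some.inj h₁
          exact Or.inr h
      · exact Or.inr hz
    have h₁ := (Finset.card_le_card hsub).trans (Finset.card_insert_le _ _)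
    have h₂ : ¬ n + 1 ≤ 2 * (star c v).card := hv
    omega
  · right
    have hsub : star (FriendsGame.join c u v) v ⊆ {u, v, (c v).getD v} := by
      intro z hz
      rw [mem_star, FriendsGame.join] at hz
      simp only [Finset.mem_insert, Finset.mem_singleton]
      split_ifs at hz with h'
      · rcases h' with rfl | rfl | ⟨h₁, -⟩
        · exact Or.inl rfl
        · exact Or.inr (Or.inl rfl)
        · simp [h₁]
      · exact absurd (hc.center _ _ hz) h
    exact (Finset.card_le_card hsub).trans Finset.card_le_three

theorem leavesPendant_join (hI : I.IsSymmetric) (hc : I.IsStars c) (hl : I.LeavesPendant c)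
    (hu : c u = none) (huv : v ∈ I.friends u) (hdeg : (I.friends u).card = 1) :
    I.LeavesPendant (FriendsGame.join c u v) := by
  intro z w hz hne
  rw [FriendsGame.join] at hz
  split_ifs at hz with h
  · obtain rfl := Option.some.inj hz
    rcases h with rfl | rfl | ⟨h, -⟩
    · exact hdeg
    · exact absurd rfl hne
    -- If `v` were a leaf of another star, her only friend would be its centre; `u` is also a friend
    -- of `v`, so `u` would be that centre, although `u` is uncovered.
    · have h₁ := hl _ _ h hne.symm
      have h₂ := hc.mem_friends _ _ h hne.symm
      obtain rfl := Finset.card_le_one.1 h₁.le _ h₂ u ((hI _ _).2 huv)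
      rw [hc.center _ _ h] at hu
      simp at hu
  · exact hl z w hz hne

theorem isBalanced_join (hc : I.IsStars c) (hb : I.IsBalanced c) (hv : ¬ IsBig c v) :
    I.IsBalanced (FriendsGame.join c u v) := by
  intro z w hz hne
  by_cases hwv : w = v
  · subst hwv
    exact Or.inr (hc.card_star_join_le hv)
  · have hsub := Finset.card_le_card (star_join_subset (c := c) (u := u) hwv)
    have hz' := mem_star.1 (star_join_subset hwv (mem_star.2 hz))
    have := hb z w hz' hne
    omega

/-- There is at most one big star. -/
theorem exists_not_isBig (hdeg : 2 ≤ (I.friends u).card) :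
    ∃ v ∈ I.friends u, ¬ IsBig c v := by
  by_contra! h
  obtain ⟨v, hv, w, hw, hvw⟩ := Finset.one_lt_card.1 hdeg
  -- Two disjoint big stars would together contain at least `n + 1` agents.
  have h₁ : n + 1 ≤ 2 * (star c v).card := h v hv
  have h₂ : n + 1 ≤ 2 * (star c w).card := h w hw
  have hdisj : Disjoint (star c v) (star c w) := by
    refine Finset.disjoint_left.2 fun z hz hz' => hvw ?_
    rw [mem_star] at hz hz'
    exact Option.some.inj (hz.symm.trans hz')
  have := Finset.card_le_univ (star c v ∪ star c w)
  rw [Finset.card_union_of_disjoint hdisj, Fintype.card_fin] at this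
  omega

theorem isApprox (hI : I.IsSymmetric) (hc : I.IsStars c) (hb : I.IsBalanced c) (hcover : ∀ i, c i ≠ none)
    {i₀ : Fin n} (h₀ : (I.friends i₀).card = 1)
    {π : Finpartition (Finset.univ : Finset (Fin n))} (hπ : ∀ i j, j ∈ π.part i ↔ c j = c i) :
    I.IsApprox (2 - 4 / ((n : ℝ) + 2)) π := by
  have hpart : ∀ i w, c i = some w → π.part i = star c w := by
    intro i w h
    ext j
    rw [hπ, mem_star, h]
  refine I.isApprox_of_star π h₀ (fun i => ?_) fun i => ?_
  · obtain ⟨w, hw⟩ := Option.ne_none_iff_exists'.1 (hcover i)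
    simp only [hpart i w hw, mem_star]
    by_cases hiw : i = w
    · subst hiw
      obtain ⟨j, hj, hji⟩ := Finset.exists_mem_ne (hc.two_le_card i hw) i
      exact ⟨j, mem_star.1 hj, (hI _ _).2 (hc.mem_friends _ _ (mem_star.1 hj) hji)⟩
    · exact ⟨w, hc.center _ _ hw, hc.mem_friends _ _ hw hiw⟩
  · obtain ⟨w, hw⟩ := Option.ne_none_iff_exists'.1 (hcover i)
    rw [hpart i w hw]
    by_contra! h
    obtain ⟨h₁, h₂, h₃⟩ := h
    obtain ⟨j, hj, hjw, hj'⟩ := h₃ w (mem_star.2 (hc.center _ _ hw))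
    rw [mem_star] at hj
    refine hj' ?_ (hc.mem_friends _ _ hj hjw)
    have := hb _ _ hj hjw
    omega

end Instance.IsStars

open RAM RAM.Expr RAM.Prog

/-! ### The program

The variables `1` and `2` run over agents, the variable `3` holds the offset of the row of the
agent in variable `1`. The array `1` holds `0` for an agent in no star, and else one plus the centre
of her star; the array `2` holds the sizes of the stars, and the array `3` the degrees. -/

/-- Compute the degrees; the variables `4` and `5` tell whether there are agents of degree zero
and of degree one. -/
def degreesProg : Prog :=
  .seq (.assign 3 (lit 0)) (forTo 1
    (.seq (forTo 2 (.store 3 (var 1) (add (cell 3 (var 1)) (cell 0 (add (var 3) (var 2))))))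
      (.seq (.cond (cell 3 (var 1))
          (.cond (sub (cell 3 (var 1)) (lit 1)) .skip (.assign 5 (lit 1))) (.assign 4 (lit 1)))
        (.assign 3 (add (var 3) (var 0))))))

/-- Move the agent `e` to the star with the label in the variable `7`. -/
def moveProg (e : Expr) : Prog :=
  .seq (.assign 8 (cell 1 e))
    (.seq (.store 2 (var 8) (sub (cell 2 (var 8)) (lit 1)))
      (.seq (.store 1 e (var 7)) (.store 2 (var 7) (add (cell 2 (var 7)) (lit 1)))))

/-- Variable 6 keeps the old label of `v`, and variable 7 holds the new one. If `v` is itself the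
centre of a star of two, the conditional move sends `v` to its own star and changes nothing. -/
def joinProg : Prog :=
  .seq (.assign 6 (cell 1 (var 2)))
    (.seq (.assign 7 (add (var 2) (lit 1)))
      (.seq (.cond (var 6) (.cond (sub (cell 2 (var 6)) (lit 2)) .skip
          (moveProg (sub (var 6) (lit 1)))) .skip)
        (.seq (moveProg (var 2)) (moveProg (var 1)))))

/-- Join every agent that is in no star to a friend for which the test `g` succeeds. -/
def passProg (g : Expr) : Prog :=
  .seq (.assign 3 (lit 0)) (forTo 1
    (.seq (forTo 2 (.cond (cell 1 (var 1)) .skip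
        (.cond (cell 0 (add (var 3) (var 2))) (.cond g joinProg .skip) .skip)))
      (.assign 3 (add (var 3) (var 0)))))

/-- The test whether an agent with friends has degree one. -/
def pendantTest : Expr := sub (lit 1) (sub (cell 3 (var 1)) (lit 1))

/-- The test whether a star is not big. -/
def notBigTest : Expr :=
  sub (add (var 0) (lit 1))
    (add (cell 2 (add (var 2) (lit 1))) (cell 2 (add (var 2) (lit 1))))

def starProg : Prog :=
  .seq degreesProg
    (.cond (var 4) (forTo 1 (.store 1 (var 1) (var 1)))
      (.cond (var 5) (.seq (passProg pendantTest) (passProg notBigTest)) .skip))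

/-! ### Its correctness -/

variable {I : Instance n} {m : Mem} {c : Fin n → Option (Fin n)}

open scoped Classical in
/-- The memory holds the number of agents and the adjacency matrix. -/
structure HoldsGraph (I : Instance n) (m : Mem) : Prop where
  var_zero : m.var 0 = n
  arr_zero (i j : Fin n) : m.arr 0 (i * n + j) = if j ∈ I.friends i then 1 else 0

/-- The memory holds the instance and the degrees. -/
structure HoldsDegrees (I : Instance n) (m : Mem) : Prop extends HoldsGraph I m where
  arr_three (i : Fin n) : m.arr 3 i = (I.friends i).card

/-- The memory holds a partial partition into stars. -/
structure HoldsStars (c : Fin n → Option (Fin n)) (m : Mem) : Prop where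
  arr_one (i : Fin n) : m.arr 1 i = (c i).elim 0 (fun w => (w : ℕ) + 1)
  arr_two (w : Fin n) : m.arr 2 (w + 1) = (star c w).card

theorem holdsGraph_input (I : Instance n) : HoldsGraph I I.input where
  var_zero := by simp [Instance.input]
  arr_zero i j := by
    have : (∃ i' j' : Fin n, (i : ℕ) * n + j = i' * n + j' ∧ j' ∈ I.friends i') ↔
        j ∈ I.friends i := by
      refine ⟨?_, fun h => ⟨i, j, rfl, h⟩⟩
      rintro ⟨i', j', h, h'⟩
      have hn : 0 < n := i.pos
      have h₁ := congrArg (· / n) h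
      have h₂ := congrArg (· % n) h
      simp only [mul_comm _ n, Nat.mul_add_div hn, Nat.mul_add_mod,  Nat.div_eq_of_lt j.2, Nat.div_eq_of_lt j'.2, Nat.mod_eq_of_lt j.2,
        Nat.mod_eq_of_lt j'.2, add_zero] at h₁ h₂
      rwa [Fin.ext h₁, Fin.ext h₂]
    simp [Instance.input, this]

/-- An uncovered agent has label 0, so the decrement hits cell 0 of array 2, which represents no
star. The condition on `e` is needed because `e` is evaluated again after variable 8 and array 2
have changed. -/
theorem wp_moveProg {e : Expr} {i j : Fin n} (hm : HoldsStars c m)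
    (he : ∀ m' : Mem, (∀ x ≠ 8, m'.var x = m.var x) → (m'.arr 1 = m.arr 1) → e.eval m' = i)
    (hj : m.var 7 = j + 1) :
    WP n (moveProg e) (fun m' => (∀ x ≠ 8, m'.var x = m.var x) ∧ m'.arr 0 = m.arr 0 ∧
      m'.arr 3 = m.arr 3 ∧ HoldsStars (Function.update c i (some j)) m') m := by
  have he₀ : e.eval m = i := he m (fun _ _ => rfl) rfl
  refine .seq (.assign (.seq (.store (.seq (.store (.store ?_))))))
  simp only [Expr.eval]
  rw [he₀, he _ (by simp +contextual) (by ext; simp)]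
  simp only [Mem.setCell_var, Mem.setCell_arr, Mem.setVar_var, Mem.setVar_arr, hj]
  refine ⟨by simp +contextual, by ext; simp, by ext; simp, fun z => ?_, fun w => ?_⟩
  · by_cases hz : z = i
    · subst hz; simp
    · simp [hz, hm.arr_one, Fin.val_inj]
  · have hstar : star (Function.update c i (some j)) w =
        if w = j then insert i (star c w) else (star c w).erase i := by
      ext z
      by_cases hz : z = i
      · subst hz
        split_ifs with h
        · simp [h]
        · simpa using Ne.symm h
      · split_ifs with h <;> simp [h, hz]
    have hlab : m.arr 1 i = w + 1 ↔ i ∈ star c w := by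
      rw [hm.arr_one, mem_star]
      cases c i <;> simp [Fin.val_inj]
    rw [hstar]
    have hw := hm.arr_two w
    by_cases hwj : w = j
    · subst hwj
      by_cases hi : i ∈ star c w
      · have := Finset.card_pos.2 ⟨i, hi⟩
        simp [hlab.2 hi, hw, Finset.insert_eq_of_mem hi]
        omega
      · have h' := mt hlab.1 hi
        simp [Ne.symm h', hw, Finset.card_insert_of_notMem hi]
    · have hwj' : (w : ℕ) ≠ j := fun h => hwj (Fin.ext h)
      by_cases hi : i ∈ star c w
      · simp [hlab.2 hi, hw, hwj, hwj', Finset.card_erase_of_mem hi]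
      · have h' := mt hlab.1 hi
        simp [Ne.symm h', hw, hwj, hwj', Finset.erase_eq_of_notMem hi]

theorem wp_joinProg {u v : Fin n} (hm : HoldsStars c m) (hu : m.var 1 = u) (hv : m.var 2 = v) :
    WP n joinProg (fun m' => (∀ x < 6, m'.var x = m.var x) ∧ m'.arr 0 = m.arr 0 ∧
      m'.arr 3 = m.arr 3 ∧ HoldsStars (join c u v) m') m := by
  refine .seq (.assign (.seq (.assign (.seq (.mono
    (Q := fun m' => (∀ x < 6, m'.var x = m.var x) ∧ m'.var 7 = v + 1 ∧ m'.arr 0 = m.arr 0 ∧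
      m'.arr 3 = m.arr 3 ∧ HoldsStars (fun z =>
        if c v = some z ∧ (star c z).card ≤ 2 then some v else c z) m') ?_ ?_)))))
  · simp only [Expr.eval, Mem.setVar_var]
    set m₁ := (m.setVar 6 (m.arr 1 (m.var 2))).setVar 7
      ((if 2 = 6 then m.arr 1 (m.var 2) else m.var 2) + 1) with hm₁
    have hm₁' : HoldsStars c m₁ := ⟨hm.arr_one, hm.arr_two⟩
    have h₆ : m₁.var 6 = (c v).elim 0 (fun w => (w : ℕ) + 1) := by
      simp [hm₁, hv, hm.arr_one]
    have h₇ : m₁.var 7 = v + 1 := by simp [hm₁, hv]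
    have hlt : ∀ x < 6, m₁.var x = m.var x := by
      intro x hx
      simp [hm₁, show x ≠ 6 by omega, show x ≠ 7 by omega]
    have hskip : (∀ z, ¬ (c v = some z ∧ (star c z).card ≤ 2)) →
        WP n .skip (fun m' => (∀ x < 6, m'.var x = m.var x) ∧ m'.var 7 = v + 1 ∧
          m'.arr 0 = m.arr 0 ∧ m'.arr 3 = m.arr 3 ∧ HoldsStars (fun z =>
            if c v = some z ∧ (star c z).card ≤ 2 then some v else c z) m') m₁ := by
      intro h
      refine .skip ⟨hlt, h₇, rfl, rfl, ?_⟩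
      simpa only [if_neg (h _)] using hm₁'
    cases hcv : c v with
    | none =>
      rw [hcv] at h₆ hskip
      exact .cond (fun h => absurd h₆ h) fun _ => hskip (by simp)
    | some y =>
      rw [hcv] at h₆ hskip
      have h₂ : m₁.arr 2 (m₁.var 6) = (star c y).card := by rw [h₆]; exact hm.arr_two y
      refine .cond (fun _ => .cond (fun h => hskip ?_) fun h => ?_) fun h => ?_
      · simp only [Expr.eval, h₂] at h
        intro z hz
        obtain rfl := Option.some.inj hz.1
        omega
      · simp only [Expr.eval, h₂] at h
        refine (wp_moveProg (i := y) (j := v) hm₁' (fun m' h _ => ?_) h₇).mono ?_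
        · simp [Expr.eval, h, h₆]
        · rintro m' ⟨h₃, h₄, h₅, h₆⟩
          refine ⟨fun x hx => (h₃ x (by omega)).trans (hlt x hx), (h₃ 7 (by simp)).trans h₇,
            h₄, h₅, ?_⟩
          convert h₆ using 1
          ext1 z
          by_cases hz : z = y
          · subst hz
            simp [show (star c z).card ≤ 2 by omega]
          · simp [hz, Ne.symm hz]
      · simp [Expr.eval, h₆] at h
  · rintro m₁ ⟨h₁, h₂, h₃, h₄, h₅⟩
    refine .seq ((wp_moveProg (i := v) (j := v) h₅ (fun m' h _ => ?_) h₂).mono ?_)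
    · simp [Expr.eval, h, h₁, hv]
    · rintro m₂ ⟨h₆, h₇, h₈, h₉⟩
      refine (wp_moveProg (i := u) (j := v) h₉ (fun m' h _ => ?_)
        ((h₆ 7 (by simp)).trans h₂)).mono ?_
      · simp [Expr.eval, h, h₁, h₆, hu]
      · rintro m₃ ⟨h₁₀, h₁₁, h₁₂, h₁₃⟩
        refine ⟨fun x hx => ?_, by rw [h₁₁, h₇, h₃], by rw [h₁₂, h₈, h₄], ?_⟩
        · rw [h₁₀ x (by omega), h₆ x (by omega), h₁ x hx]
        · convert h₁₃ using 1
          ext1 z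
          by_cases hzu : z = u
          · simp [join, hzu]
          · by_cases hzv : z = v
            · simp [join, hzv, Function.update_apply]
            · simp [join, hzu, hzv]

/-- The memory during a pass: it holds stars with the property `P`. -/
def PassState (I : Instance n) (P : (Fin n → Option (Fin n)) → Prop) (m : Mem) : Prop :=
  HoldsDegrees I m ∧ ∃ c, HoldsStars c m ∧ P c

theorem HoldsDegrees.congr {m' : Mem} (hm : HoldsDegrees I m) (h : m'.var 0 = m.var 0)
    (h₀ : m'.arr 0 = m.arr 0) (h₃ : m'.arr 3 = m.arr 3) : HoldsDegrees I m' where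
  var_zero := h.trans hm.var_zero
  arr_zero := h₀ ▸ hm.arr_zero
  arr_three := h₃ ▸ hm.arr_three

theorem PassState.setVar {P : (Fin n → Option (Fin n)) → Prop} (hm : PassState I P m) {x : ℕ}
    (hx : x ≠ 0) (a : ℕ) : PassState I P (m.setVar x a) := by
  obtain ⟨h, c, hc, hP⟩ := hm
  exact ⟨h.congr (by simp [hx.symm]) rfl rfl, c, ⟨hc.arr_one, hc.arr_two⟩, hP⟩

theorem PassState.mono {P P' : (Fin n → Option (Fin n)) → Prop} (hm : PassState I P m)
    (h : ∀ c, P c → P' c) : PassState I P' m :=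
  ⟨hm.1, hm.2.imp fun c hc => ⟨hc.1, h c hc.2⟩⟩

/-- A pass with the test `g` keeps the invariant `P` of the stars and covers the agents in `D`. -/
theorem wp_passProg {g : Expr} {P : (Fin n → Option (Fin n)) → Prop}
    {G : (Fin n → Option (Fin n)) → Fin n → Fin n → Prop} {D : Fin n → Prop}
    (hg : ∀ (m : Mem) (c : Fin n → Option (Fin n)) (u v : Fin n), HoldsDegrees I m →
      HoldsStars c m → m.var 1 = u → m.var 2 = v → v ∈ I.friends u →
      (g.eval m ≠ 0 ↔ G c u v))
    (hP : ∀ c u v, P c → c u = none → v ∈ I.friends u → G c u v → P (join c u v))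
    (hD : ∀ c u, P c → c u = none → D u → ∃ v ∈ I.friends u, G c u v)
    (hm : PassState I P m) :
    WP n (passProg g) (PassState I fun c => P c ∧ ∀ u, D u → c u ≠ none) m := by
  refine .seq (.assign (.forTo (fun k m => m.var 1 = k ∧ m.var 3 = k * n ∧
    PassState I (fun c => P c ∧ ∀ u : Fin n, u < k → D u → c u ≠ none) m) ?_ ?_ ?_ ?_))
  · rintro k m ⟨h₁, h₂, h₃⟩
    exact ⟨h₃.1.var_zero, h₁⟩
  · refine ⟨by simp, by simp [Expr.eval], ?_⟩
    refine ((hm.setVar (by simp) _).setVar (by simp) _).mono fun c hc => ⟨hc, ?_⟩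
    simp
  · rintro k hk m ⟨h₁, h₂, h₃⟩
    -- As long as agent `k` is uncovered, this row has not changed the stars, so all earlier failed
    -- tests remain valid. If she were uncovered at the end, no friend would pass, against `hD`. The
    -- offset `k * n` is kept by repeated addition since there is no multiplication.
    refine .seq (.mono (.forTo (fun j m => m.var 1 = k ∧ m.var 2 = j ∧ m.var 3 = k * n ∧
      PassState I (fun c => (P c ∧ ∀ u : Fin n, u < k → D u → c u ≠ none) ∧
        (c ⟨k, hk⟩ = none → ∀ v : Fin n, v < j → v ∈ I.friends ⟨k, hk⟩ → ¬ G c ⟨k, hk⟩ v)) m)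
      ?_ ?_ ?_ fun m h => h) ?_)
    · rintro j m ⟨-, h₁, -, h₂⟩
      exact ⟨h₂.1.var_zero, h₁⟩
    · refine ⟨by simp [h₁], by simp, by simp [h₂], ?_⟩
      refine (h₃.setVar (by simp) _).mono fun c hc => ⟨hc, ?_⟩
      simp
    · rintro j hj m ⟨h₁, h₂, h₃, h₄, c, h₅, ⟨h₆, h₇⟩, h₈⟩
      have hstay : (c ⟨k, hk⟩ = none → (⟨j, hj⟩ : Fin n) ∈ I.friends ⟨k, hk⟩ →
          ¬ G c ⟨k, hk⟩ ⟨j, hj⟩) → WP n .skip (fun m' => m'.var 2 = j ∧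
          (m'.setVar 2 (j + 1)).var 1 = k ∧ (m'.setVar 2 (j + 1)).var 2 = j + 1 ∧
          (m'.setVar 2 (j + 1)).var 3 = k * n ∧
          PassState I (fun c => (P c ∧ ∀ u : Fin n, u < k → D u → c u ≠ none) ∧
            (c ⟨k, hk⟩ = none → ∀ v : Fin n, v < j + 1 → v ∈ I.friends ⟨k, hk⟩ →
              ¬ G c ⟨k, hk⟩ v)) (m'.setVar 2 (j + 1))) m := by
        intro h
        refine .skip ⟨h₂, by simp [h₁], by simp, by simp [h₃],
          PassState.setVar ⟨h₄, c, h₅, ⟨h₆, h₇⟩, fun hn v hv => ?_⟩ (by simp) _⟩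
        rcases (Nat.lt_succ_iff_lt_or_eq.1 hv) with hv | hv
        · exact h₈ hn v hv
        · obtain rfl : v = ⟨j, hj⟩ := Fin.ext hv
          exact h hn
      have e₁ : m.arr 1 (m.var 1) = (c ⟨k, hk⟩).elim 0 (fun w => (w : ℕ) + 1) := by
        rw [h₁]; exact h₅.arr_one ⟨k, hk⟩
      have e₂ := h₄.arr_zero ⟨k, hk⟩ ⟨j, hj⟩
      refine .cond (fun h => hstay fun hn => ?_) fun h => .cond (fun h' => .cond (fun h'' => ?_)
        fun h'' => hstay fun _ hf => ?_) fun h' => hstay fun _ hf => ?_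
      · simp [Expr.eval, e₁, hn] at h
      · have hn : c ⟨k, hk⟩ = none := by
          cases hc : c ⟨k, hk⟩ with
          | none => rfl
          | some w => simp [Expr.eval, e₁, hc] at h
        have hf : (⟨j, hj⟩ : Fin n) ∈ I.friends ⟨k, hk⟩ := by
          by_contra hf
          simp only [Expr.eval, h₂, h₃] at h'
          rw [if_neg hf] at e₂
          exact h' e₂
        have hG := (hg m c ⟨k, hk⟩ ⟨j, hj⟩ h₄ h₅ h₁ h₂ hf).1 h''
        refine (wp_joinProg (u := ⟨k, hk⟩) (v := ⟨j, hj⟩) h₅ h₁ h₂).mono ?_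
        rintro m' ⟨g₁, g₂, g₃, g₄⟩
        refine ⟨by rw [g₁ 2 (by simp), h₂], by simp [g₁, h₁], by simp, by simp [g₁, h₃],
          PassState.setVar ⟨h₄.congr (g₁ 0 (by simp)) g₂ g₃, _, g₄, ⟨hP c _ _ h₆ hn hf hG,
            fun u hu hu' => join_ne_none (h₇ u hu hu')⟩, fun h => ?_⟩ (by simp) _⟩
        exact absurd h (join_self_ne_none _ _ _)
      · exact mt (hg m c ⟨k, hk⟩ ⟨j, hj⟩ h₄ h₅ h₁ h₂ hf).2 (not_not.2 h'')
      · simp only [Expr.eval, h₂, h₃] at h'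
        rw [if_pos hf] at e₂
        exact absurd (h'.symm.trans e₂) (by simp)
    · rintro m ⟨h₁, -, h₂, h₃⟩
      refine .assign ⟨by simp [h₁], by simp, ?_, ?_⟩
      · simp [Expr.eval, h₂, h₃.1.var_zero, add_mul]
      · refine ((h₃.setVar (by simp) _).setVar (by simp) _).mono ?_
        rintro c ⟨⟨h₄, h₅⟩, h₆⟩
        refine ⟨h₄, fun u hu hDu => ?_⟩
        rcases (Nat.lt_succ_iff_lt_or_eq.1 hu) with hu | hu
        · exact h₅ u hu hDu
        · obtain rfl : u = ⟨k, hk⟩ := Fin.ext hu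
          intro hn
          obtain ⟨v, hv, hG⟩ := hD c _ h₄ hn hDu
          exact h₆ hn v v.2 hv hG
  · rintro m ⟨-, -, h⟩
    exact h.mono fun c hc => ⟨hc.1, fun u => hc.2 u u.2⟩

theorem wp_passes (hI : I.IsSymmetric) (hdeg : ∀ i, (I.friends i).card ≠ 0)
    (hm : HoldsDegrees I m) (hc : HoldsStars (fun _ : Fin n => none) m) :
    WP n (.seq (passProg pendantTest) (passProg notBigTest)) (fun m =>
      ∃ c, HoldsStars c m ∧ I.IsStars c ∧ I.IsBalanced c ∧ ∀ i, c i ≠ none) m := by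
  refine .seq ((wp_passProg (P := fun c => I.IsStars c ∧ I.LeavesPendant c)
    (G := fun _ u _ => (I.friends u).card = 1) (D := fun u => (I.friends u).card = 1)
    ?_ ?_ ?_ ⟨hm, _, hc, ⟨by simp, by simp, by simp⟩, by simp [Instance.LeavesPendant]⟩).mono
    fun m hm => ?_)
  · intro m c u v hm hc hu hv huv
    have := hdeg u
    simp only [pendantTest, Expr.eval, hu, hm.arr_three]
    omega
  · rintro c u v ⟨h₁, h₂⟩ hu huv hd
    exact ⟨h₁.join hI hu huv, h₁.leavesPendant_join hI h₂ hu huv hd⟩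
  · rintro c u - - hd
    obtain ⟨v, hv⟩ := Finset.card_pos.1 (Nat.pos_of_ne_zero (hdeg u))
    exact ⟨v, hv, hd⟩
  · refine (wp_passProg (P := fun c => (I.IsStars c ∧ I.IsBalanced c) ∧
      ∀ u, (I.friends u).card = 1 → c u ≠ none) (G := fun c _ v => ¬ IsBig c v)
      (D := fun _ => True) ?_ ?_ ?_ (hm.mono ?_)).mono ?_
    · intro m c u v hm hc hu hv huv
      simp only [notBigTest, Expr.eval, hv, hc.arr_two, hm.var_zero, IsBig]
      omega
    · rintro c u v ⟨⟨h₁, h₂⟩, h₃⟩ hu huv hd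
      exact ⟨⟨h₁.join hI hu huv, h₁.isBalanced_join h₂ hd⟩,
        fun z hz => join_ne_none (h₃ z hz)⟩
    · rintro c u ⟨-, h⟩ hu -
      have h₁ : (I.friends u).card ≠ 1 := fun h' => h u h' hu
      have h₂ := hdeg u
      exact Instance.IsStars.exists_not_isBig (by omega)
    · rintro c ⟨⟨h₁, h₂⟩, h₃⟩
      -- After the first pass stars of any size are balanced, because all leaves are pendant.
      exact ⟨⟨h₁, fun u w hu huw => Or.inl (h₂ u w hu huw)⟩, h₃⟩
    · rintro m ⟨-, c, h₁, ⟨⟨h₂, h₃⟩, -⟩, h₄⟩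
      exact ⟨c, h₁, h₂, h₃, fun i => h₄ i trivial⟩

/-! ### Computation of the degrees -/

theorem card_filter_lt_succ (s : Finset (Fin n)) {j : ℕ} (hj : j < n) :
    (s.filter (fun v : Fin n => (v : ℕ) < j + 1)).card =
      (s.filter (fun v : Fin n => (v : ℕ) < j)).card + if (⟨j, hj⟩ : Fin n) ∈ s then 1 else 0 := by
  have hne : (⟨j, hj⟩ : Fin n) ∉ s.filter (fun v : Fin n => (v : ℕ) < j) := by simp
  have hiff : ∀ v : Fin n, (v : ℕ) < j + 1 ↔ v = ⟨j, hj⟩ ∨ (v : ℕ) < j := by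
    intro v; rw [Fin.ext_iff]; simp only; omega
  split_ifs with h
  · rw [← Finset.card_insert_of_notMem hne]
    congr 1
    ext v
    simp only [Finset.mem_filter, Finset.mem_insert, hiff]
    constructor
    · tauto
    · rintro (rfl | h')
      · exact ⟨h, Or.inl rfl⟩
      · exact ⟨h'.1, Or.inr h'.2⟩
  · rw [add_zero]
    congr 1
    ext v
    simp only [Finset.mem_filter, hiff]
    constructor
    · rintro ⟨h₁, rfl | h₂⟩
      · exact absurd h₁ h
      · exact ⟨h₁, h₂⟩
    · tauto

/-- The memory when the degrees of the first `k` agents are known. -/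
structure DegreesBelow (I : Instance n) (k : ℕ) (m : Mem) : Prop extends HoldsGraph I m where
  arr_one (i : ℕ) : m.arr 1 i = 0
  arr_two (i : ℕ) : m.arr 2 i = 0
  arr_three (i : Fin n) : m.arr 3 i = if i < k then (I.friends i).card else 0
  var_four : m.var 4 ≠ 0 ↔ ∃ i : Fin n, i < k ∧ (I.friends i).card = 0
  var_five : m.var 5 ≠ 0 ↔ ∃ i : Fin n, i < k ∧ (I.friends i).card = 1

theorem wp_degreesProg (I : Instance n) : WP n degreesProg (DegreesBelow I n) I.input := by
  refine .seq (.assign (.forTo (fun k m => m.var 1 = k ∧ m.var 3 = k * n ∧ DegreesBelow I k m)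
    ?_ ?_ ?_ fun m h => h.2.2))
  · rintro k m ⟨h₁, h₂, h₃⟩
    exact ⟨h₃.var_zero, h₁⟩
  · have h := holdsGraph_input I
    exact ⟨by simp, by simp [Expr.eval], ⟨by simp [h.var_zero], h.arr_zero⟩,
      by simp [Instance.input], by simp [Instance.input], by simp [Instance.input],
      by simp [Instance.input], by simp [Instance.input]⟩
  · rintro k hk m ⟨h₁, h₂, h₃⟩
    refine .seq (.mono (.forTo (fun j m => m.var 1 = k ∧ m.var 2 = j ∧ m.var 3 = k * n ∧
      HoldsGraph I m ∧ (∀ i, m.arr 1 i = 0) ∧ (∀ i, m.arr 2 i = 0) ∧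
      (∀ i : Fin n, m.arr 3 i = if i < k then (I.friends i).card else if (i : ℕ) = k then
        ((I.friends i).filter (fun v : Fin n => (v : ℕ) < j)).card else 0) ∧
      (m.var 4 ≠ 0 ↔ ∃ i : Fin n, i < k ∧ (I.friends i).card = 0) ∧
      (m.var 5 ≠ 0 ↔ ∃ i : Fin n, i < k ∧ (I.friends i).card = 1)) ?_ ?_ ?_ fun m h => h) ?_)
    · rintro j m ⟨-, h₁, -, h₂, -⟩
      exact ⟨h₂.var_zero, h₁⟩
    · exact ⟨by simp [h₁], by simp, by simp [h₂], ⟨by simp [h₃.var_zero], h₃.arr_zero⟩,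
        h₃.arr_one, h₃.arr_two, by simp [h₃.arr_three], by simpa using h₃.var_four,
        by simpa using h₃.var_five⟩
    · rintro j hj m ⟨h₁, h₂, h₃, h₄, h₅, h₆, h₇, h₈, h₉⟩
      have e := h₄.arr_zero ⟨k, hk⟩ ⟨j, hj⟩
      refine .store ⟨by simpa using h₂, by simpa using h₁, by simp, by simpa using h₃,
        ⟨by simpa using h₄.var_zero, by simpa using h₄.arr_zero⟩, by simpa using h₅,
        by simpa using h₆, fun i => ?_, by simpa using h₈, by simpa using h₉⟩
      have h := h₇ ⟨k, hk⟩
      simp only [lt_irrefl, if_false, if_true] at h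
      by_cases hik : (i : ℕ) = k
      · obtain rfl : i = ⟨k, hk⟩ := Fin.ext hik
        simp only [Mem.setVar_arr, Mem.setCell_arr, Expr.eval, h₁, h₂, h₃, e, h, and_self,
          lt_irrefl, if_true, if_false, card_filter_lt_succ _ hj]
      · simp [Expr.eval, h₁, hik, h₇]
    · rintro m ⟨h₁, -, h₃, h₄, h₅, h₆, h₇, h₈, h₉⟩
      have e : m.arr 3 (m.var 1) = (I.friends ⟨k, hk⟩).card := by
        have h := h₇ ⟨k, hk⟩
        simp only [lt_irrefl, if_false, if_true] at h
        rw [h₁, h, Finset.filter_true_of_mem fun v _ => v.2]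
      have h₃' : ∀ i : Fin n, m.arr 3 i = if i < k + 1 then (I.friends i).card else 0 := by
        intro i
        by_cases hik : (i : ℕ) = k
        · obtain rfl : i = ⟨k, hk⟩ := Fin.ext hik
          rw [if_pos (Nat.lt_succ_self _), ← e, h₁]
        · rw [h₇ i, if_neg hik]
          exact if_congr (by omega) rfl rfl
      have hsucc : ∀ q : ℕ → Prop, (∃ i : Fin n, i < k + 1 ∧ q (I.friends i).card) ↔
          (∃ i : Fin n, i < k ∧ q (I.friends i).card) ∨ q (I.friends ⟨k, hk⟩).card := by
        intro q
        constructor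
        · rintro ⟨i, hi, hq⟩
          rcases Nat.lt_succ_iff_lt_or_eq.1 hi with hi | hi
          · exact Or.inl ⟨i, hi, hq⟩
          · obtain rfl : i = ⟨k, hk⟩ := Fin.ext hi
            exact Or.inr hq
        · rintro (⟨i, hi, hq⟩ | hq)
          · exact ⟨i, by omega, hq⟩
          · exact ⟨_, Nat.lt_succ_self _, hq⟩
      have hz := hsucc (· = 0)
      have ho := hsucc (· = 1)
      have hn := h₄.var_zero
      refine .seq (.cond (fun h => .cond (fun h' => .skip (.assign ?_))
        fun h' => .assign (.assign ?_)) fun h => .assign (.assign ?_))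
      all_goals
        simp only [Expr.eval, e] at h
        try simp only [Expr.eval, e] at h'
        refine ⟨by simp [h₁], by simp, by simp [Expr.eval, h₃, hn, add_mul],
          ⟨by simp [hn], by simpa using h₄.arr_zero⟩, by simpa using h₅, by simpa using h₆,
          by simpa using h₃', ?_, ?_⟩
      · rw [hz, ← h₈, or_iff_left h]; simp
      · rw [ho, ← h₉]; simp; omega
      · rw [hz, ← h₈, or_iff_left h]; simp
      · rw [ho]; simp [Expr.eval]; omega
      · rw [hz]; simp [Expr.eval, h]
      · rw [ho, ← h₉]; simp [h]

/-! ### The three cases assembled -/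

theorem wp_singletons (hm : m.var 0 = n) :
    WP n (forTo 1 (.store 1 (var 1) (var 1))) (fun m => ∀ i : Fin n, m.arr 1 i = i) m := by
  refine .forTo (fun k m => m.var 0 = n ∧ m.var 1 = k ∧ ∀ i : Fin n, i < k → m.arr 1 i = i)
    (fun k m h => ⟨h.1, h.2.1⟩) ⟨by simp [hm], by simp, by simp⟩ ?_
    fun m h i => h.2.2 i i.2
  rintro k hk m ⟨h₁, h₂, h₃⟩
  refine .store ⟨by simp [h₂], by simp [h₁], by simp, fun i hi => ?_⟩
  by_cases hik : (i : ℕ) = k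
  · simp [Expr.eval, h₂, hik]
  · simpa [Expr.eval, h₂, hik] using h₃ i (by omega)

theorem wp_starProg (hI : I.IsSymmetric) :
    WP n starProg (fun m => I.IsApprox (2 - 4 / ((n : ℝ) + 2)) (output n m)) I.input := by
  refine .seq ((wp_degreesProg I).mono fun m hm => .cond (fun h => ?_) fun h =>
    .cond (fun h' => ?_) fun h' => .skip ?_)
  · obtain ⟨i₀, -, h₀⟩ := hm.var_four.1 h
    refine (wp_singletons hm.var_zero).mono fun m' hm' =>
      I.isApprox_of_degree_eq_zero _ _ h₀ fun i => ?_
    ext j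
    rw [mem_part_output, hm', hm', Finset.mem_singleton, Fin.ext_iff]
  · obtain ⟨i₀, -, h₀⟩ := hm.var_five.1 h'
    have hdeg : ∀ i, (I.friends i).card ≠ 0 := fun i hi => hm.var_four.2 ⟨i, i.2, hi⟩ h
    refine (wp_passes hI hdeg ⟨hm.toHoldsGraph, by simp [hm.arr_three]⟩
      ⟨by simp [hm.arr_one], by simp [hm.arr_two, star]⟩).mono ?_
    rintro m' ⟨c, h₁, h₂, h₃, h₄⟩
    refine h₂.isApprox hI h₃ h₄ h₀ fun i j => ?_
    rw [mem_part_output, h₁.arr_one, h₁.arr_one]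
    cases c i <;> cases c j <;> simp [Fin.val_inj]
  · refine I.isApprox_of_two_le_degree _ (fun i => ?_) fun i => ?_
    · have h₁ : (I.friends i).card ≠ 0 := fun hi => hm.var_four.2 ⟨i, i.2, hi⟩ h
      have h₂ : (I.friends i).card ≠ 1 := fun hi => hm.var_five.2 ⟨i, i.2, hi⟩ h'
      omega
    -- Array 1 is still identically zero, so the output is the grand coalition.
    · ext j
      simp [mem_part_output, hm.arr_one]

end FriendsGame

theorem mainTheorem7 :
    ∃ (P : RAM.Prog) (p : Polynomial ℕ), ∀ (n : ℕ) (I : FriendsGame.Instance n), I.IsSymmetric →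
      ∃ (t : ℕ) (m : RAM.Mem), RAM.Exec P I.input t m ∧ t ≤ p.eval n ∧
        I.IsApprox (2 - 4 / ((n : ℝ) + 2)) (FriendsGame.output n m) :=
  -- The witnesses are `starProg` and `starProg.time`, neither of which depends on `n`.
  ⟨_, _, fun _ _ hI => FriendsGame.wp_starProg hI⟩
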